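/- Let $X$ be a complex manifold of dimension $n$ and let $(E,h^E)$ be a holomorphic vector bundle of rank $r$ over $X$ with a smooth Hermitian metric (linear in the first and conjugate linear in the second variable). Let $R^E$ be its Chern curvature: for a local holomorphic frame $(e_i)$ and local holomorphic coordinates $(z^\alpha)$, with $\partial_\alpha=\partial/\partial z^\alpha$ and $h_{i\bar k}=h^E(e_i,e_k)$ (and $(h^{\bar k j})$ the inverse matrix), set $\theta^j_i=\partial h_{i\bar k}\,h^{\bar k j}$, $R^j_i=\bar\partial\theta^j_i=R^j_{i\alpha\bar\beta}\,dz^\alpha\wedge d\bar z^\beta$ and $R_{i\bar j\alpha\bar\beta}=R^k_{i\alpha\bar\beta}h_{k\bar j}$ (summation convention). We say that $(E,h^E)$ is *strongly decomposably positive of type I* if for every $x\in X$ there is a decomposition $T^{1,0}_xX=U_x\oplus V_x$ such that - $R_{i\bar j\alpha\bar\beta}u^{i\alpha}\overline{u^{j\beta}}>0$ for every non-zero $u=u^{i\alpha}e_i\otimes\partial_\alpha\in E_x\otimes U_x$; - $R_{i\bar j\alpha\bar\beta}u^{i\alpha}\overline{v'^{j\beta}}=0$ for all $u=u^{i\alpha}e_i\otimes\partial_\alpha\in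 E_x\otimes U_x$ and $v'=v'^{j\beta}e_j\otimes\partial_\beta\in E_x\otimes V_x$; - $R_{i\bar j\alpha\bar\beta}v^{\bar j\alpha}\overline{v^{\bar i\beta}}>0$ for every non-zero $v=v^{\bar j\alpha}\bar e_j\otimes\partial_\alpha\in\overline{E}_x\otimes V_x$. We say that $(E,h^E)$ is *strongly decomposably positive of type II* if for every $x\in X$ there is an orthogonal decomposition $E_x=E_{1,x}\oplus E_{2,x}$ with respect to which $R^E_x$ is block diagonal (all endomorphisms $R^E_x(v,\bar w)$, $v,w\in T^{1,0}_xX$, preserve $E_{1,x}$ and $E_{2,x}$), and such that - $R_{i\bar j\alpha\bar\beta}u^{i\alpha}\overline{u^{j\beta}}>0$ for every non-zero $u=u^{i\alpha}e_i\otimes\partial_\alpha\in E_{1,x}\otimes T^{1,0}_xX$; - $R_{i\bar j\alpha\bar\beta}v^{i\bar\beta}\overline{v^{j\bar\alpha}}>0$ for every non-zero $v=v^{i\bar\beta}e_i\otimes\partial_{\bar\beta}\in E_{2,x}\otimes T^{0,1}_xX$. We say that $(E,h^E)$ is *decomposably positive* (Finski) if for every $x\in X$ there are a number $N\in\mathbb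 N$, sesquilinear forms $l_p:T^{1,0}_xX\times E_x\to\mathbb C$ (conjugate linear in the first and linear in the second variable) and bilinear forms $l'_p:T^{1,0}_xX\times E_x\to\mathbb C$, $p=1,\dots,N$, such that for all $v\in T^{1,0}_xX$ and $\xi\in E_x$ $$\frac1{2\pi}\langle R^E_x(v,\bar v)\xi,\xi\rangle_{h^E}=\sum_{p=1}^N|l_p(v,\xi)|^2+\sum_{p=1}^N|l'_p(v,\xi)|^2,$$ and moreover $\langle R^E_x(v,\bar v)\xi,\xi\rangle_{h^E}\neq0$ whenever $v\neq0$ and $\xi\neq0$. **Corollary 2.6.** If $(E,h^E)$ is strongly decomposably positive of type I or of type II, then $(E,h^E)$ is decomposably positive. -/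

import Mathlib

open Bundle Module
open scoped Manifold ContDiff ComplexConjugate ComplexOrder Matrix

noncomputable section

/-! A complex manifold `X` of dimension `n` is a manifold modelled holomorphically on `ℂⁿ`; its
tangent space over `ℂ` at `x`, `TangentSpace 𝓘(ℂ, ℂⁿ) x`, is the holomorphic tangent space
`T¹'⁰ₓX`. A holomorphic vector bundle of rank `r` is a holomorphic vector bundle over `ℂ` with
model fibre `ℂʳ`. -/

/-- The model space `ℂᵏ`. -/
abbrev CSpace (k : ℕ) : Type := EuclideanSpace ℂ (Fin k)

/-- The Wirtinger derivative `∂f/∂z^α`, where `z^α = x^α + √-1 y^α`. -/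
def wirtinger {n : ℕ} (α : Fin n) (f : CSpace n → ℂ) (z : CSpace n) : ℂ :=
  (1 / 2) * (fderiv ℝ f z (EuclideanSpace.single α 1)
    - Complex.I * fderiv ℝ f z (EuclideanSpace.single α Complex.I))

/-- The conjugate Wirtinger derivative `∂f/∂z̄^α`. -/
def wirtingerBar {n : ℕ} (α : Fin n) (f : CSpace n → ℂ) (z : CSpace n) : ℂ :=
  (1 / 2) * (fderiv ℝ f z (EuclideanSpace.single α 1)
    + Complex.I * fderiv ℝ f z (EuclideanSpace.single α Complex.I))

/-- The standard basis of `ℂᵏ`. -/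
def stdBasis (k : ℕ) : Basis (Fin k) ℂ (CSpace k) :=
  (EuclideanSpace.basisFun (Fin k) ℂ).toBasis

section TangentFrame

variable {n : ℕ} {X : Type*} [TopologicalSpace X] [ChartedSpace (CSpace n) X]

/-- The coordinate frame `(∂_α)` of `T¹'⁰ₓX` given by the coordinates `chartAt x`
(Mathlib identifies the tangent space at `x` with the model space through this chart). -/
def tangentFrame (x : X) : Basis (Fin n) ℂ (TangentSpace 𝓘(ℂ, CSpace n) x) :=
  stdBasis n

end TangentFrame

section HermitianBundle

variable {n r : ℕ} {X : Type*} [TopologicalSpace X] [ChartedSpace (CSpace n) X]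
  (E : X → Type*) [∀ x, AddCommGroup (E x)] [∀ x, Module ℂ (E x)] [∀ x, TopologicalSpace (E x)]
  [TopologicalSpace (TotalSpace (CSpace r) E)] [FiberBundle (CSpace r) E]
  [VectorBundle ℂ (CSpace r) E]

/-- The local holomorphic frame `(e_i)` of `E` over a neighbourhood of `x₀`, coming from the
preferred local trivialization of `E` at `x₀`. -/
def localHolFrame (x₀ : X) (i : Fin r) (y : X) : E y :=
  (trivializationAt (CSpace r) E x₀).localFrame (stdBasis r) i y

/-- The basis `(e_i(x))` of the fibre `E_x`. -/
def fibreFrame (x : X) : Basis (Fin r) ℂ (E x) :=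
  (trivializationAt (CSpace r) E x).basisAt (stdBasis r)
    (FiberBundle.mem_baseSet_trivializationAt (CSpace r) E x)

/-- The local frame `(e_i)` around `x` takes the value `fibreFrame E x` at `x`. -/
theorem localHolFrame_self (x : X) (i : Fin r) : localHolFrame E x i x = fibreFrame E x i :=
  (trivializationAt (CSpace r) E x).localFrame_apply_of_mem_baseSet (stdBasis r)
    (FiberBundle.mem_baseSet_trivializationAt (CSpace r) E x)

variable (n r) in
/-- The part of the coordinate chart at `x₀` over which the local frame at `x₀` is defined. -/
def frameDomain (x₀ : X) : Set (CSpace n) :=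
  {z | z ∈ (chartAt (CSpace n) x₀).target ∧
    (chartAt (CSpace n) x₀).symm z ∈ (trivializationAt (CSpace r) E x₀).baseSet}

variable (n r) in
/-- A (smooth) Hermitian metric on `E`: a family of Hermitian inner products on the fibres, linear
in the first and conjugate linear in the second variable, with coefficients `h(e_i, e_j)` that are
`C^∞` functions of the (real) coordinates. -/
structure HermitianMetric where
  /-- The sesquilinear form on each fibre. -/
  form : ∀ x, E x →ₗ[ℂ] E x →ₗ⋆[ℂ] ℂ
  conj_symm : ∀ x (ξ η : E x), conj (form x ξ η) = form x η ξ
  pos : ∀ x (ξ : E x), ξ ≠ 0 → 0 < form x ξ ξ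
  smooth : ∀ (x₀ : X) (i j : Fin r),
    ContDiffOn ℝ ∞
      (fun z : CSpace n => form ((chartAt (CSpace n) x₀).symm z)
        (localHolFrame E x₀ i ((chartAt (CSpace n) x₀).symm z))
        (localHolFrame E x₀ j ((chartAt (CSpace n) x₀).symm z)))
      (frameDomain n r E x₀)

namespace HermitianMetric

variable {E} (h : HermitianMetric n r E)

/-- The matrix `(h_{i k̄})` (`i` row, `k` column), `h_{i k̄} = h(e_i, e_k)`, of the metric in the
local holomorphic frame around `x₀`, as a function of the coordinates around `x₀`. -/
def localMatrix (x₀ : X) (z : CSpace n) : Matrix (Fin r) (Fin r) ℂ :=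
  Matrix.of fun i k => h.form ((chartAt (CSpace n) x₀).symm z)
    (localHolFrame E x₀ i ((chartAt (CSpace n) x₀).symm z))
    (localHolFrame E x₀ k ((chartAt (CSpace n) x₀).symm z))

/-- The coefficient `θ^j_{i α}` of `dz^α` in the connection form `θ^j_i = ∂h_{i k̄} h^{k̄ j}` of the
Chern connection, in the local holomorphic frame and coordinates around `x₀`. -/
def connectionForm (x₀ : X) (j i : Fin r) (α : Fin n) (z : CSpace n) : ℂ :=
  ∑ k, wirtinger α (fun w => h.localMatrix x₀ w i k) z * (h.localMatrix x₀ z)⁻¹ k j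

/-- The matrix `(R^j_{i α β̄})` (`j` row, `i` column) of coefficients of `dz^α ∧ dz̄^β` in the Chern
curvature `R^j_i = ∂̄θ^j_i` at `x`; as `dz̄^β ∧ dz^α = - dz^α ∧ dz̄^β`, it equals
`- ∂θ^j_{i α}/∂z̄^β`. -/
def curvatureMatrix (x : X) (α β : Fin n) : Matrix (Fin r) (Fin r) ℂ :=
  Matrix.of fun j i =>
    - wirtingerBar β (h.connectionForm x j i α) (chartAt (CSpace n) x x)

/-- The Chern curvature endomorphism `R_x(v, w̄) = v^α w̄^β R^j_{i α β̄} e_j ⊗ e^i` of `E_x`, for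
`v, w ∈ T¹'⁰ₓX`. -/
def chernCurvature (x : X) (v w : TangentSpace 𝓘(ℂ, CSpace n) x) : E x →ₗ[ℂ] E x :=
  ∑ α, ∑ β, ((tangentFrame x).repr v α * conj ((tangentFrame x).repr w β)) •
    Matrix.toLin (fibreFrame E x) (fibreFrame E x) (h.curvatureMatrix x α β)

/-- The component `R_{i j̄ α β̄} = R^k_{i α β̄} h_{k j̄}`, that is, `⟨R(∂_α, ∂_β̄) e_i, e_j⟩`, at `x`. -/
def curvatureCoeff (x : X) (i j : Fin r) (α β : Fin n) : ℂ :=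
  h.form x (h.chernCurvature x (tangentFrame x α) (tangentFrame x β) (fibreFrame E x i))
    (fibreFrame E x j)

/-- The Nakano form `R_{i j̄ α β̄} u^{iα} \overline{w^{jβ}}` at `x`, for the tensors
`u^{iα} e_i ⊗ ∂_α` and `w^{jβ} e_j ⊗ ∂_β` of `E_x ⊗ T¹'⁰ₓX`. -/
def nakanoForm (x : X) (u w : Fin r → Fin n → ℂ) : ℂ :=
  ∑ i, ∑ j, ∑ α, ∑ β, h.curvatureCoeff x i j α β * u i α * conj (w j β)

/-- The dual Nakano form `R_{i j̄ α β̄} v^{j̄α} \overline{v^{īβ}}` at `x`, for the tensor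
`v^{j̄α} ē_j ⊗ ∂_α` of `Ē_x ⊗ T¹'⁰ₓX`. -/
def dualNakanoForm (x : X) (v : Fin r → Fin n → ℂ) : ℂ :=
  ∑ i, ∑ j, ∑ α, ∑ β, h.curvatureCoeff x i j α β * v j α * conj (v i β)

/-- Strong decomposable positivity of type I: at each point `x` there is a decomposition
`T¹'⁰ₓX = U ⊕ V` such that the curvature is Nakano positive on `E_x ⊗ U`, dual Nakano positive on
`Ē_x ⊗ V`, and the cross terms between `E_x ⊗ U` and `E_x ⊗ V` vanish. As `(e_i)` is a basis of
`E_x`, a tensor `u^{iα} e_i ⊗ ∂_α` lies in `E_x ⊗ U` iff `u^{iα} ∂_α ∈ U` for every `i`; likewise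
for `Ē_x ⊗ V` with the basis `(ē_i)`. -/
def StronglyDecomposablyPositiveI : Prop :=
  ∀ x : X, ∃ U V : Submodule ℂ (TangentSpace 𝓘(ℂ, CSpace n) x), IsCompl U V ∧
    (∀ u : Fin r → Fin n → ℂ, (∀ i, ∑ α, u i α • tangentFrame x α ∈ U) → u ≠ 0 →
      0 < h.nakanoForm x u u) ∧
    (∀ u v' : Fin r → Fin n → ℂ, (∀ i, ∑ α, u i α • tangentFrame x α ∈ U) →
      (∀ j, ∑ β, v' j β • tangentFrame x β ∈ V) → h.nakanoForm x u v' = 0) ∧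
    (∀ v : Fin r → Fin n → ℂ, (∀ j, ∑ α, v j α • tangentFrame x α ∈ V) → v ≠ 0 →
      0 < h.dualNakanoForm x v)

/-- Strong decomposable positivity of type II: at each point `x` there is an orthogonal
decomposition `E_x = E₁ ⊕ E₂` for which the Chern curvature is block diagonal (the curvature
endomorphisms preserve `E₁` and `E₂`), Nakano positive on `E₁ ⊗ T¹'⁰ₓX`, and with
`R_{i j̄ α β̄} v^{i β̄} \overline{v^{j ᾱ}} > 0` for non-zero `v = v^{i β̄} e_i ⊗ ∂_β̄` in
`E₂ ⊗ T⁰'¹ₓX`. As `(∂_α)` is a basis, `u^{iα} e_i ⊗ ∂_α` lies in `E₁ ⊗ T¹'⁰ₓX` iff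
`u^{iα} e_i ∈ E₁` for every `α`; likewise for `E₂ ⊗ T⁰'¹ₓX` with the basis `(∂_β̄)`. -/
def StronglyDecomposablyPositiveII : Prop :=
  ∀ x : X, ∃ E₁ E₂ : Submodule ℂ (E x), IsCompl E₁ E₂ ∧
    (∀ ξ ∈ E₁, ∀ η ∈ E₂, h.form x ξ η = 0) ∧
    (∀ v w : TangentSpace 𝓘(ℂ, CSpace n) x,
      (∀ ξ ∈ E₁, h.chernCurvature x v w ξ ∈ E₁) ∧ (∀ η ∈ E₂, h.chernCurvature x v w η ∈ E₂)) ∧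
    (∀ u : Fin r → Fin n → ℂ, (∀ α, ∑ i, u i α • fibreFrame E x i ∈ E₁) → u ≠ 0 →
      0 < h.nakanoForm x u u) ∧
    (∀ v : Fin r → Fin n → ℂ, (∀ β, ∑ i, v i β • fibreFrame E x i ∈ E₂) → v ≠ 0 →
      0 < ∑ i, ∑ j, ∑ α, ∑ β, h.curvatureCoeff x i j α β * v i β * conj (v j α))

/-- Decomposable non-negativity: at each point `x`, `(1/2π) ⟨R_x(v, v̄)ξ, ξ⟩` is a finite sum of
squared moduli of forms `l_p(v, ξ)` that are sesquilinear and `l'_p(v, ξ)` that are bilinear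
(linear on `T¹'⁰ₓX ⊗ E_x`). -/
def DecomposablyNonneg : Prop :=
  ∀ x : X, ∃ (N : ℕ)
    (l : Fin N → TangentSpace 𝓘(ℂ, CSpace n) x →ₗ⋆[ℂ] E x →ₗ[ℂ] ℂ)
    (l' : Fin N → TangentSpace 𝓘(ℂ, CSpace n) x →ₗ[ℂ] E x →ₗ[ℂ] ℂ),
    ∀ (v : TangentSpace 𝓘(ℂ, CSpace n) x) (ξ : E x),
      (1 / (2 * Real.pi) : ℂ) * h.form x (h.chernCurvature x v v ξ) ξ =
        ((∑ p, ‖l p v ξ‖ ^ 2 + ∑ p, ‖l' p v ξ‖ ^ 2 : ℝ) : ℂ)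

/-- Decomposable positivity: decomposable non-negativity, and moreover `⟨R_x(v, v̄)ξ, ξ⟩ ≠ 0` for
non-zero `v` and `ξ`. -/
def DecomposablyPositive : Prop :=
  h.DecomposablyNonneg ∧
    ∀ (x : X) (v : TangentSpace 𝓘(ℂ, CSpace n) x) (ξ : E x), v ≠ 0 → ξ ≠ 0 →
      h.form x (h.chernCurvature x v v ξ) ξ ≠ 0

end HermitianMetric

end HermitianBundle

end

/-! At a point `x`, the number `⟨R(v, v̄)ξ, ξ⟩` can be read in two ways: as the value on `ξ ⊗ v` of
the Nakano form, or, with the roles of `α` and `β` exchanged, as the value on `ξ ⊗ v̄` of a second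
sesquilinear form on tensors. A form that is non-negative on a subspace is there a sum of squares
`|φ_p|²` with `φ_p` linear (factor its Gram matrix as `B* B`). Evaluated on `ξ ⊗ v` the `φ_p` are
bilinear in `(v, ξ)`; on `ξ ⊗ v̄` they are conjugate linear in `v`. These are the forms `l'_p` and
`l_p`.

It remains to split `⟨R(v, v̄)ξ, ξ⟩` into one term of each kind without cross terms. For type I, `v`
is split along `U ⊕ V`: one cross term vanishes by hypothesis, the other by the Hermitian symmetry
of the curvature (`conj_curvatureCoeff`). For type II, `ξ` is split along `E₁ ⊕ E₂`, and block
diagonality with orthogonality removes both cross terms. Both cases feed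
`exists_sum_norm_sq_of_split`. Non-vanishing holds because one of the two rank-one tensors is
non-zero, where its form is strictly positive. -/

open scoped MatrixOrder in
/-- A sesquilinear form that is non-negative on a subspace is there a sum of squared moduli of
linear forms. -/
theorem exists_sum_norm_sq_of_nonneg {W : Type*} [AddCommGroup W] [Module ℂ W]
    [FiniteDimensional ℂ W] (Q : W →ₗ[ℂ] W →ₗ⋆[ℂ] ℂ) (S : Submodule ℂ W)
    (hQ : ∀ u ∈ S, 0 ≤ Q u u) :
    ∃ φ : Fin (finrank ℂ W) → W →ₗ[ℂ] ℂ,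
      ∀ u ∈ S, Q u u = ((∑ p, ‖φ p u‖ ^ 2 : ℝ) : ℂ) := by
  -- Composing `Q` with a linear projection `P` onto `S` makes it non-negative on all of `W` without
  -- changing it on `S`.
  obtain ⟨P, hP⟩ := S.subtype.exists_leftInverse_of_injective S.ker_subtype
  have hPS : ∀ u ∈ S, (P u : W) = u := fun u hu => by
    have := LinearMap.congr_fun hP ⟨u, hu⟩
    simpa using congrArg Subtype.val this
  let b := finBasis ℂ W
  -- The indices are transposed because `Q` is linear in its first slot, whereas `star x ⬝ᵥ (A *ᵥ
  -- x)` is conjugate linear in its first factor.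
  let A : Matrix (Fin (finrank ℂ W)) (Fin (finrank ℂ W)) ℂ :=
    Matrix.of fun p q => Q (P (b q)) (P (b p))
  have hA : ∀ u : W, star (b.repr u : Fin (finrank ℂ W) → ℂ) ⬝ᵥ (A *ᵥ (b.repr u)) =
      Q (P u) (P u) := fun u => by
    have hu : (P u : W) = ∑ q, b.repr u q • (P (b q) : W) := by
      conv_lhs => rw [← b.sum_repr u]
      simp only [map_sum, map_smul, Submodule.coe_sum, Submodule.coe_smul]
    rw [hu]
    simp only [dotProduct, Matrix.mulVec, map_sum, LinearMap.sum_apply, A, Matrix.of_apply,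
      Finset.mul_sum, LinearMap.map_smulₛₗ, LinearMap.smul_apply, smul_eq_mul, Pi.star_apply]
    refine Finset.sum_congr rfl fun p _ => Finset.sum_congr rfl fun q _ => ?_
    simp only [RCLike.star_def, RingHom.id_apply]
    ring
  have hpsd : A.PosSemidef := by
    refine Matrix.posSemidef_iff_dotProduct_mulVec.2 ?_
    have hnn : ∀ x : Fin (finrank ℂ W) → ℂ, 0 ≤ star x ⬝ᵥ (A *ᵥ x) := fun x => by
      have := hA (b.equivFun.symm x)
      rw [← Basis.equivFun_apply, LinearEquiv.apply_symm_apply] at this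
      rw [this]
      exact hQ _ (P _).2
    refine ⟨Matrix.IsHermitian.ext fun p q => ?_, hnn⟩
    -- Polarization: realness of the form at `b p + b q` and `b p + i b q` forces `A` to be
    -- Hermitian.
    have him : ∀ w : W, (Q (P w) (P w)).im = 0 := fun w =>
      (Complex.nonneg_iff.1 (hQ _ (P w).2)).2.symm
    have h0 := him (b p)
    have h1 := him (b q)
    have h2 := him (b p + b q)
    have h3 := him (b p + Complex.I • b q)
    simp only [map_add, map_smul, Submodule.coe_add, Submodule.coe_smul, LinearMap.add_apply,
      LinearMap.smul_apply, LinearMap.map_smulₛₗ, smul_eq_mul, Complex.conj_I, Complex.add_im,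
      Complex.mul_im, Complex.mul_re, Complex.add_re, Complex.neg_im, Complex.neg_re, Complex.I_re,
      Complex.I_im] at h2 h3
    apply Complex.ext
    · simp only [A, Matrix.of_apply, RCLike.star_def, Complex.conj_re]
      linarith
    · simp only [A, Matrix.of_apply, RCLike.star_def, Complex.conj_im]
      linarith
  obtain ⟨B, hB⟩ := CStarAlgebra.nonneg_iff_eq_star_mul_self.1 hpsd.nonneg
  refine ⟨fun p => LinearMap.proj p ∘ₗ B.mulVecLin ∘ₗ b.equivFun.toLinearMap, fun u hu => ?_⟩
  have := hA u
  rw [hPS u hu] at this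
  rw [← this, hB, Matrix.star_eq_conjTranspose, ← Matrix.mulVec_mulVec, Matrix.dotProduct_mulVec, Matrix.vecMul_conjTranspose,
    star_star]
  simp only [dotProduct, Pi.star_apply, RCLike.star_def, LinearMap.comp_apply,
    LinearMap.proj_apply, Complex.ofReal_sum, Complex.ofReal_pow]
  refine Finset.sum_congr rfl fun p _ => ?_
  rw [← Complex.conj_mul']
  rfl

/-! ### Wirtinger calculus -/

section Wirtinger

variable {n : ℕ} {f g : CSpace n → ℂ} {z : CSpace n}

theorem conj_wirtinger (α : Fin n) (f : CSpace n → ℂ) (z : CSpace n) :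
    conj (wirtinger α f z) = wirtingerBar α (fun w => conj (f w)) z := by
  have h : fderiv ℝ (fun w => conj (f w)) z =
      (Complex.conjCLE : ℂ →L[ℝ] ℂ).comp (fderiv ℝ f z) :=
    Complex.conjCLE.comp_fderiv
  simp [wirtinger, wirtingerBar, h, Complex.conj_ofNat]

theorem conj_wirtingerBar (α : Fin n) (f : CSpace n → ℂ) (z : CSpace n) :
    conj (wirtingerBar α f z) = wirtinger α (fun w => conj (f w)) z := by
  have h : fderiv ℝ (fun w => conj (f w)) z =
      (Complex.conjCLE : ℂ →L[ℝ] ℂ).comp (fderiv ℝ f z) :=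
    Complex.conjCLE.comp_fderiv
  simp [wirtinger, wirtingerBar, h, sub_eq_add_neg, Complex.conj_ofNat]

theorem wirtingerBar_congr (β : Fin n) (h : f =ᶠ[nhds z] g) :
    wirtingerBar β f z = wirtingerBar β g z := by
  simp only [wirtingerBar, h.fderiv_eq]

theorem wirtingerBar_sum_mul {ι : Type*} [Fintype ι] {f g : ι → CSpace n → ℂ} (β : Fin n)
    (hf : ∀ j, DifferentiableAt ℝ (f j) z) (hg : ∀ j, DifferentiableAt ℝ (g j) z) :
    wirtingerBar β (fun w => ∑ j, f j w * g j w) z =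
      ∑ j, (f j z * wirtingerBar β (g j) z + wirtingerBar β (f j) z * g j z) := by
  have h : fderiv ℝ (fun w => ∑ j, f j w * g j w) z =
      ∑ j, (f j z • fderiv ℝ (g j) z + g j z • fderiv ℝ (f j) z) := by
    rw [fderiv_fun_sum fun j _ => (hf j).fun_mul (hg j)]
    exact Finset.sum_congr rfl fun j _ => fderiv_fun_mul (hf j) (hg j)
  simp only [wirtingerBar, h, sum_apply, add_apply, smul_apply, smul_eq_mul, Finset.mul_sum, ← Finset.sum_add_distrib]
  refine Finset.sum_congr rfl fun j _ => ?_
  ring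

theorem ContDiffAt.differentiableAt_fderiv_apply (hf : ContDiffAt ℝ ∞ f z) (a : CSpace n) :
    DifferentiableAt ℝ (fun w => fderiv ℝ f w a) z :=
  ((hf.fderiv_right (m := 1) (by norm_num [ENat.LEInfty.out])).differentiableAt (by simp)).clm_apply
    (differentiableAt_const a)

theorem ContDiffAt.fderiv_fderiv_apply_comm (hf : ContDiffAt ℝ ∞ f z) (a b : CSpace n) :
    fderiv ℝ (fun w => fderiv ℝ f w a) z b = fderiv ℝ (fun w => fderiv ℝ f w b) z a := by
  have hd : DifferentiableAt ℝ (fderiv ℝ f) z :=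
    (hf.fderiv_right (m := 1) (by norm_num [ENat.LEInfty.out])).differentiableAt (by simp)
  have key : ∀ a b : CSpace n,
      fderiv ℝ (fun w => fderiv ℝ f w a) z b = fderiv ℝ (fderiv ℝ f) z b a := fun a b => by
    rw [fderiv_clm_apply hd (differentiableAt_const a)]
    simp
  rw [key, key]
  exact hf.isSymmSndFDerivAt (by simpa using ENat.LEInfty.out) b a

theorem ContDiffAt.differentiableAt_wirtinger (hf : ContDiffAt ℝ ∞ f z) (α : Fin n) :
    DifferentiableAt ℝ (wirtinger α f) z :=
  ((hf.differentiableAt_fderiv_apply _).sub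
    ((hf.differentiableAt_fderiv_apply _).const_mul _)).const_mul _

/-- Both operators are constant-coefficient combinations of real directional derivatives, which
commute on smooth functions. -/
theorem ContDiffAt.wirtingerBar_wirtinger_comm (hf : ContDiffAt ℝ ∞ f z) (α β : Fin n) :
    wirtingerBar β (wirtinger α f) z = wirtinger α (wirtingerBar β f) z := by
  have h1 : ∀ a : CSpace n, fderiv ℝ (wirtinger α f) z a =
      (1 / 2) * (fderiv ℝ (fun w => fderiv ℝ f w (EuclideanSpace.single α 1)) z a -
        Complex.I * fderiv ℝ (fun w => fderiv ℝ f w (EuclideanSpace.single α Complex.I)) z a) := by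
    intro a
    have := (((hf.differentiableAt_fderiv_apply (EuclideanSpace.single α 1)).hasFDerivAt.sub
      ((hf.differentiableAt_fderiv_apply
        (EuclideanSpace.single α Complex.I)).hasFDerivAt.const_mul Complex.I)).const_mul
          (1 / 2 : ℂ)).fderiv
    exact (congrArg (fun L : CSpace n →L[ℝ] ℂ => L a) this).trans (by simp)
  have h2 : ∀ a : CSpace n, fderiv ℝ (wirtingerBar β f) z a =
      (1 / 2) * (fderiv ℝ (fun w => fderiv ℝ f w (EuclideanSpace.single β 1)) z a +
        Complex.I * fderiv ℝ (fun w => fderiv ℝ f w (EuclideanSpace.single β Complex.I)) z a) := by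
    intro a
    have := (((hf.differentiableAt_fderiv_apply (EuclideanSpace.single β 1)).hasFDerivAt.add
      ((hf.differentiableAt_fderiv_apply
        (EuclideanSpace.single β Complex.I)).hasFDerivAt.const_mul Complex.I)).const_mul
          (1 / 2 : ℂ)).fderiv
    exact (congrArg (fun L : CSpace n →L[ℝ] ℂ => L a) this).trans (by simp [mul_add])
  rw [wirtingerBar, wirtinger, h1, h1, h2, h2,
    hf.fderiv_fderiv_apply_comm (EuclideanSpace.single β 1),
    hf.fderiv_fderiv_apply_comm (EuclideanSpace.single β 1),
    hf.fderiv_fderiv_apply_comm (EuclideanSpace.single β Complex.I),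
    hf.fderiv_fderiv_apply_comm (EuclideanSpace.single β Complex.I)]
  ring

end Wirtinger

/-! ### Hermitian symmetry of the Chern curvature in a frame -/

section ChernSymmetry

variable {n r : ℕ} {H : CSpace n → Matrix (Fin r) (Fin r) ℂ} {z : CSpace n}

/-- Cramer's rule: the entries of the inverse are polynomials in the entries of `H` divided by the
determinant. -/
theorem differentiableAt_matrix_inv_apply
    (hH : ∀ i j, DifferentiableAt ℝ (fun w => H w i j) z) (hdet : (H z).det ≠ 0)
    (i j : Fin r) : DifferentiableAt ℝ (fun w => (H w)⁻¹ i j) z := by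
  have hd : ∀ M : CSpace n → Matrix (Fin r) (Fin r) ℂ,
      (∀ i j, DifferentiableAt ℝ (fun w => M w i j) z) →
        DifferentiableAt ℝ (fun w => (M w).det) z := fun M hM => by
    simp only [Matrix.det_apply']
    fun_prop
  have hadj : DifferentiableAt ℝ (fun w => (H w).adjugate i j) z := by
    simp only [Matrix.adjugate_apply]
    refine hd _ fun k l => ?_
    by_cases hk : k = j
    · subst hk
      simp
    · simpa [Matrix.updateRow_ne hk] using hH k l
  simp only [Matrix.inv_def, Matrix.smul_apply, Ring.inverse_eq_inv', smul_eq_mul]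
  exact ((hd H hH).inv hdet).mul hadj

/-- The coefficients of the Chern curvature, with the upper index lowered, in terms of the
derivatives of the metric. -/
theorem sum_neg_wirtingerBar_connection_mul
    (hH : ∀ i j, ContDiffAt ℝ ∞ (fun w => H w i j) z)
    (hdet : ∀ᶠ w in nhds z, (H w).det ≠ 0) (i l : Fin r) (α β : Fin n) :
    ∑ j, -wirtingerBar β (fun w => ∑ k, wirtinger α (fun w => H w i k) w * (H w)⁻¹ k j) z *
        H z j l =
      ∑ j, ∑ k, wirtinger α (fun w => H w i k) z * (H z)⁻¹ k j *
        wirtingerBar β (fun w => H w j l) z -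
      wirtingerBar β (wirtinger α (fun w => H w i l)) z := by
  have hH1 : ∀ i j, DifferentiableAt ℝ (fun w => H w i j) z := fun i j =>
    (hH i j).differentiableAt (by simp)
  have hθ : ∀ j, DifferentiableAt ℝ
      (fun w => ∑ k, wirtinger α (fun w => H w i k) w * (H w)⁻¹ k j) z := fun j =>
    DifferentiableAt.fun_sum fun k _ => ((hH i k).differentiableAt_wirtinger α).mul
      (differentiableAt_matrix_inv_apply hH1 hdet.self_of_nhds k j)
  -- Near `z` one has `θ h = ∂h`, so the Leibniz rule gives `-(∂̄θ) h = θ ∂̄h - ∂̄∂h` and `h⁻¹` is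
  -- never differentiated explicitly.
  have hev : (fun w => ∑ j, (∑ k, wirtinger α (fun w => H w i k) w * (H w)⁻¹ k j) * H w j l)
      =ᶠ[nhds z] wirtinger α (fun w => H w i l) := by
    filter_upwards [hdet] with w hw
    have h1 : (H w)⁻¹ * H w = 1 := Matrix.nonsing_inv_mul _ (isUnit_iff_ne_zero.2 hw)
    simp only [Finset.sum_mul, mul_assoc]
    rw [Finset.sum_comm]
    simp only [← Finset.mul_sum, ← Matrix.mul_apply, h1, Matrix.one_apply]
    simp
  rw [← wirtingerBar_congr β hev, wirtingerBar_sum_mul β hθ fun j => hH1 j l]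
  simp only [Finset.sum_add_distrib, Finset.sum_mul, neg_mul, Finset.sum_neg_distrib]
  ring

/-- In the expression `∂h h⁻¹ ∂̄h - ∂̄∂h`, conjugation exchanges `∂` and `∂̄` and transposes `h` and
`h⁻¹`; the second-order term is symmetric because `∂` and `∂̄` commute. -/
theorem conj_sum_neg_wirtingerBar_connection_mul
    (hH : ∀ i j, ContDiffAt ℝ ∞ (fun w => H w i j) z)
    (hdet : ∀ᶠ w in nhds z, (H w).det ≠ 0) (hherm : ∀ w, (H w).IsHermitian)
    (i l : Fin r) (α β : Fin n) :
    conj (∑ j, -wirtingerBar β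
        (fun w => ∑ k, wirtinger α (fun w => H w i k) w * (H w)⁻¹ k j) z * H z j l) =
      ∑ j, -wirtingerBar α
        (fun w => ∑ k, wirtinger β (fun w => H w l k) w * (H w)⁻¹ k j) z * H z j i := by
  have hc : ∀ i j, (fun w => conj (H w i j)) = fun w => H w j i := fun i j =>
    funext fun w => (hherm w).apply j i
  have hinv : ∀ i j, conj ((H z)⁻¹ i j) = (H z)⁻¹ j i := fun i j => (hherm z).inv.apply j i
  have h2 : conj (wirtingerBar β (wirtinger α (fun w => H w i l)) z) =
      wirtingerBar α (wirtinger β (fun w => H w l i)) z := by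
    rw [conj_wirtingerBar, (hH l i).wirtingerBar_wirtinger_comm]
    simp only [conj_wirtinger, hc]
  rw [sum_neg_wirtingerBar_connection_mul hH hdet, sum_neg_wirtingerBar_connection_mul hH hdet,
    map_sub, h2]
  congr 1
  simp only [map_sum, map_mul, conj_wirtinger, conj_wirtingerBar, hc, hinv]
  rw [Finset.sum_comm]
  refine Finset.sum_congr rfl fun j _ => Finset.sum_congr rfl fun k _ => ?_
  ring

end ChernSymmetry

theorem frameDomain_mem_nhds (n r : ℕ) {X : Type*} [TopologicalSpace X]
    [ChartedSpace (CSpace n) X] (E : X → Type*) [∀ x, AddCommGroup (E x)]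
    [∀ x, TopologicalSpace (E x)] [TopologicalSpace (TotalSpace (CSpace r) E)]
    [FiberBundle (CSpace r) E] (x : X) :
    frameDomain n r E x ∈ nhds (chartAt (CSpace n) x x) := by
  refine ((chartAt (CSpace n) x).isOpen_inter_preimage_symm
    (trivializationAt (CSpace r) E x).open_baseSet).mem_nhds ⟨mem_chart_target _ x, ?_⟩
  rw [Set.mem_preimage, (chartAt (CSpace n) x).left_inv (mem_chart_source _ x)]
  exact FiberBundle.mem_baseSet_trivializationAt (CSpace r) E x

/-! ### The curvature as a form on tensors -/

section HermitianBundle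

variable {n r : ℕ} {X : Type*} [TopologicalSpace X] [ChartedSpace (CSpace n) X]
  {E : X → Type*} [∀ x, AddCommGroup (E x)] [∀ x, Module ℂ (E x)] [∀ x, TopologicalSpace (E x)]
  [TopologicalSpace (TotalSpace (CSpace r) E)] [FiberBundle (CSpace r) E]
  [VectorBundle ℂ (CSpace r) E]

variable (n r E) in
/-- The tensor `ξ ⊗ v ∈ E_x ⊗ T¹'⁰ₓX` in coordinates. -/
noncomputable def tensorCoord (x : X) (v : TangentSpace 𝓘(ℂ, CSpace n) x) (ξ : E x) : Fin r → Fin n → ℂ :=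
  fun i α => (fibreFrame E x).repr ξ i * (tangentFrame x).repr v α

variable (n r E) in
/-- The tensor `ξ ⊗ v̄ ∈ E_x ⊗ T⁰'¹ₓX` in coordinates. -/
noncomputable def tensorConjCoord (x : X) (v : TangentSpace 𝓘(ℂ, CSpace n) x) (ξ : E x) : Fin r → Fin n → ℂ :=
  fun i α => (fibreFrame E x).repr ξ i * conj ((tangentFrame x).repr v α)

theorem tensorCoord_ne_zero {x : X} {v : TangentSpace 𝓘(ℂ, CSpace n) x} {ξ : E x} (hv : v ≠ 0)
    (hξ : ξ ≠ 0) : tensorCoord n r E x v ξ ≠ 0 := by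
  intro h0
  obtain ⟨i, hi⟩ : ∃ i, (fibreFrame (r := r) E x).repr ξ i ≠ 0 := by
    by_contra! hc
    exact hξ ((fibreFrame (r := r) E x).ext_elem fun i => by simpa using hc i)
  refine hv ((tangentFrame x).ext_elem fun α => ?_)
  have := congrFun (congrFun h0 i) α
  simpa [tensorCoord, hi] using this

theorem tensorConjCoord_ne_zero {x : X} {v : TangentSpace 𝓘(ℂ, CSpace n) x} {ξ : E x}
    (hv : v ≠ 0) (hξ : ξ ≠ 0) : tensorConjCoord n r E x v ξ ≠ 0 := by
  intro h0
  obtain ⟨i, hi⟩ : ∃ i, (fibreFrame (r := r) E x).repr ξ i ≠ 0 := by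
    by_contra! hc
    exact hξ ((fibreFrame (r := r) E x).ext_elem fun i => by simpa using hc i)
  refine hv ((tangentFrame x).ext_elem fun α => ?_)
  have := congrFun (congrFun h0 i) α
  simpa [tensorConjCoord, hi] using this

/-- The sesquilinear form with coefficients `c i j α β` on tensors `u^{iα}`. -/
noncomputable def tensorForm (c : Fin r → Fin r → Fin n → Fin n → ℂ) :
    (Fin r → Fin n → ℂ) →ₗ[ℂ] (Fin r → Fin n → ℂ) →ₗ⋆[ℂ] ℂ :=
  LinearMap.mk₂'ₛₗ (RingHom.id ℂ) (starRingEnd ℂ)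
    (fun u w => ∑ i, ∑ j, ∑ α, ∑ β, c i j α β * u i α * conj (w j β))
    (fun u u' w => by
      simp only [Pi.add_apply, mul_add, add_mul, Finset.sum_add_distrib])
    (fun a u w => by
      simp only [Finset.mul_sum, RingHom.id_apply, smul_eq_mul, Pi.smul_apply]
      refine Finset.sum_congr rfl fun i _ => Finset.sum_congr rfl fun j _ =>
        Finset.sum_congr rfl fun α _ => Finset.sum_congr rfl fun β _ => ?_
      ring)
    (fun u w w' => by
      simp only [Pi.add_apply, map_add, mul_add, Finset.sum_add_distrib])
    (fun a u w => by
      simp only [Finset.mul_sum, smul_eq_mul, Pi.smul_apply, map_mul]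
      refine Finset.sum_congr rfl fun i _ => Finset.sum_congr rfl fun j _ =>
        Finset.sum_congr rfl fun α _ => Finset.sum_congr rfl fun β _ => ?_
      ring)

theorem tensorForm_apply (c : Fin r → Fin r → Fin n → Fin n → ℂ) (u w : Fin r → Fin n → ℂ) :
    tensorForm c u w = ∑ i, ∑ j, ∑ α, ∑ β, c i j α β * u i α * conj (w j β) := rfl

namespace HermitianMetric

variable (h : HermitianMetric n r E)

theorem isHermitian_localMatrix (x₀ : X) (z : CSpace n) : (h.localMatrix x₀ z).IsHermitian :=
  Matrix.IsHermitian.ext fun _ _ => h.conj_symm _ _ _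

/-- A left null vector `a` of the Gram matrix would give a non-zero `ξ = ∑ a_i e_i` with `h(ξ, ξ) =
0`. -/
theorem det_localMatrix_ne_zero {x₀ : X} {z : CSpace n} (hz : z ∈ frameDomain n r E x₀) :
    (h.localMatrix x₀ z).det ≠ 0 := by
  intro h0
  obtain ⟨a, ha, haM⟩ := Matrix.exists_vecMul_eq_zero_iff.2 h0
  set y := (chartAt (CSpace n) x₀).symm z
  let b := (trivializationAt (CSpace r) E x₀).basisAt (stdBasis r) hz.2
  have hb : ∀ i, localHolFrame E x₀ i y = b i := fun i =>
    (trivializationAt (CSpace r) E x₀).localFrame_apply_of_mem_baseSet (stdBasis r) hz.2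
  have hξ : h.form y (b.equivFun.symm a) (b.equivFun.symm a) = 0 := by
    have : ∀ k, ∑ i, a i * h.form y (b i) (b k) = 0 := fun k => by
      simpa [Matrix.vecMul, dotProduct, localMatrix, ← hb] using congrFun haM k
    simp only [Basis.equivFun_symm_apply, map_sum, LinearMap.sum_apply, map_smul,
      LinearMap.smul_apply, LinearMap.map_smulₛₗ, smul_eq_mul]
    refine Finset.sum_eq_zero fun k _ => ?_
    simp only [this k, mul_zero]
  by_cases hne : b.equivFun.symm a = 0
  · exact ha (b.equivFun.symm.map_eq_zero_iff.1 hne)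
  · exact (h.pos y _ hne).ne' hξ

theorem localMatrix_chartAt_self (x : X) (i j : Fin r) :
    h.localMatrix x (chartAt (CSpace n) x x) i j =
      h.form x (fibreFrame E x i) (fibreFrame E x j) := by
  rw [← localHolFrame_self, ← localHolFrame_self, localMatrix, Matrix.of_apply,
    (chartAt (CSpace n) x).left_inv (mem_chart_source _ x)]

theorem chernCurvature_tangentFrame (x : X) (α β : Fin n) :
    h.chernCurvature x (tangentFrame x α) (tangentFrame x β) =
      Matrix.toLin (fibreFrame E x) (fibreFrame E x) (h.curvatureMatrix x α β) := by
  simp [chernCurvature, Finsupp.single_apply, Finset.sum_ite_eq]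

theorem curvatureCoeff_eq_sum (x : X) (i j : Fin r) (α β : Fin n) :
    h.curvatureCoeff x i j α β = ∑ k, h.curvatureMatrix x α β k i *
      h.localMatrix x (chartAt (CSpace n) x x) k j := by
  simp [curvatureCoeff, chernCurvature_tangentFrame, Matrix.toLin_self, localMatrix_chartAt_self]

/-- The Chern curvature is Hermitian: `\overline{R_{i j̄ α β̄}} = R_{j ī β ᾱ}`. -/
theorem conj_curvatureCoeff (x : X) (i j : Fin r) (α β : Fin n) :
    conj (h.curvatureCoeff x i j α β) = h.curvatureCoeff x j i β α := by
  have hD := frameDomain_mem_nhds n r E x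
  rw [curvatureCoeff_eq_sum, curvatureCoeff_eq_sum]
  exact conj_sum_neg_wirtingerBar_connection_mul
    (fun i j => (h.smooth x i j).contDiffAt hD)
    (Filter.mem_of_superset hD fun _ hw => h.det_localMatrix_ne_zero hw)
    (h.isHermitian_localMatrix x) i j α β

theorem conj_nakanoForm (x : X) (u w : Fin r → Fin n → ℂ) :
    conj (h.nakanoForm x u w) = h.nakanoForm x w u := by
  simp only [nakanoForm, map_sum, map_mul, conj_curvatureCoeff, Complex.conj_conj]
  rw [Finset.sum_comm]
  refine Finset.sum_congr rfl fun i _ => Finset.sum_congr rfl fun j _ => ?_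
  rw [Finset.sum_comm]
  refine Finset.sum_congr rfl fun α _ => Finset.sum_congr rfl fun β _ => ?_
  ring

theorem chernCurvature_eq_sum (x : X) (v w : TangentSpace 𝓘(ℂ, CSpace n) x) :
    h.chernCurvature x v w =
      ∑ α, ∑ β, ((tangentFrame x).repr v α * conj ((tangentFrame x).repr w β)) •
        h.chernCurvature x (tangentFrame x α) (tangentFrame x β) := by
  simp only [chernCurvature_tangentFrame]
  rfl

theorem chernCurvature_add_left (x : X) (v v' w : TangentSpace 𝓘(ℂ, CSpace n) x) :
    h.chernCurvature x (v + v') w = h.chernCurvature x v w + h.chernCurvature x v' w := by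
  simp only [chernCurvature, map_add, Finsupp.add_apply, add_mul, add_smul,
    Finset.sum_add_distrib]

theorem chernCurvature_add_right (x : X) (v w w' : TangentSpace 𝓘(ℂ, CSpace n) x) :
    h.chernCurvature x v (w + w') = h.chernCurvature x v w + h.chernCurvature x v w' := by
  simp only [chernCurvature, map_add, Finsupp.add_apply, mul_add, add_smul,
    Finset.sum_add_distrib]

theorem form_chernCurvature (x : X) (v w : TangentSpace 𝓘(ℂ, CSpace n) x) (ξ η : E x) :
    h.form x (h.chernCurvature x v w ξ) η =
      h.nakanoForm x (tensorCoord n r E x v ξ) (tensorCoord n r E x w η) := by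
  conv_lhs => rw [chernCurvature_eq_sum, ← (fibreFrame (r := r) E x).sum_repr ξ,
    ← (fibreFrame (r := r) E x).sum_repr η]
  simp only [LinearMap.sum_apply, LinearMap.smul_apply, map_sum, map_smul, LinearMap.map_smulₛₗ,
    smul_eq_mul, nakanoForm, curvatureCoeff, tensorCoord, map_mul, Finset.mul_sum]
  rw [Finset.sum_comm]
  refine Finset.sum_congr rfl fun i _ => Finset.sum_congr rfl fun j _ =>
    Finset.sum_congr rfl fun α _ => Finset.sum_congr rfl fun β _ => ?_
  ring

/-- This holds only on rank-one tensors: the factor `v^α v̄^β` may be read with `v̄^β` as the linear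
coordinate and `v^α` as its conjugate. -/
theorem nakanoForm_eq_tensorForm_conj (x : X) (v : TangentSpace 𝓘(ℂ, CSpace n) x) (ξ : E x) :
    h.nakanoForm x (tensorCoord n r E x v ξ) (tensorCoord n r E x v ξ) =
      tensorForm (fun i j α β => h.curvatureCoeff x i j β α)
        (tensorConjCoord n r E x v ξ) (tensorConjCoord n r E x v ξ) := by
  simp only [nakanoForm, tensorForm_apply, tensorCoord, tensorConjCoord, map_mul,
    Complex.conj_conj]
  refine Finset.sum_congr rfl fun i _ => Finset.sum_congr rfl fun j _ => ?_
  rw [Finset.sum_comm]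
  refine Finset.sum_congr rfl fun α _ => Finset.sum_congr rfl fun β _ => ?_
  ring

/-- If `⟨R_x(v, v̄)ξ, ξ⟩` splits into two parts on which the Nakano form and its conjugate
counterpart are positive, then it is a sum of squared moduli of bilinear and of sesquilinear
forms, and vanishes only for `v = 0` or `ξ = 0`. -/
theorem exists_sum_norm_sq_of_split (x : X)
    (P Q : TangentSpace 𝓘(ℂ, CSpace n) x →ₗ[ℂ] TangentSpace 𝓘(ℂ, CSpace n) x)
    (P' Q' : E x →ₗ[ℂ] E x) (S S' : Submodule ℂ (Fin r → Fin n → ℂ))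
    (hS : ∀ v ξ, tensorCoord n r E x (P v) (P' ξ) ∈ S)
    (hS' : ∀ v ξ, tensorConjCoord n r E x (Q v) (Q' ξ) ∈ S')
    (hpos : ∀ u ∈ S, u ≠ 0 → 0 < h.nakanoForm x u u)
    (hpos' : ∀ u ∈ S', u ≠ 0 →
      0 < tensorForm (fun i j α β => h.curvatureCoeff x i j β α) u u)
    (hsplit : ∀ v ξ, h.form x (h.chernCurvature x v v ξ) ξ =
      h.form x (h.chernCurvature x (P v) (P v) (P' ξ)) (P' ξ) +
        h.form x (h.chernCurvature x (Q v) (Q v) (Q' ξ)) (Q' ξ))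
    (hne : ∀ v ξ, v ≠ 0 → ξ ≠ 0 → (P v ≠ 0 ∧ P' ξ ≠ 0) ∨ (Q v ≠ 0 ∧ Q' ξ ≠ 0)) :
    (∃ (N : ℕ)
      (l : Fin N → TangentSpace 𝓘(ℂ, CSpace n) x →ₗ⋆[ℂ] E x →ₗ[ℂ] ℂ)
      (l' : Fin N → TangentSpace 𝓘(ℂ, CSpace n) x →ₗ[ℂ] E x →ₗ[ℂ] ℂ),
      ∀ (v : TangentSpace 𝓘(ℂ, CSpace n) x) (ξ : E x),
        (1 / (2 * Real.pi) : ℂ) * h.form x (h.chernCurvature x v v ξ) ξ =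
          ((∑ p, ‖l p v ξ‖ ^ 2 + ∑ p, ‖l' p v ξ‖ ^ 2 : ℝ) : ℂ)) ∧
    ∀ (v : TangentSpace 𝓘(ℂ, CSpace n) x) (ξ : E x), v ≠ 0 → ξ ≠ 0 →
      h.form x (h.chernCurvature x v v ξ) ξ ≠ 0 := by
  have hnn : ∀ u ∈ S, 0 ≤ tensorForm (h.curvatureCoeff x) u u := fun u hu => by
    rcases eq_or_ne u 0 with rfl | h0
    · simp
    · exact (hpos u hu h0).le
  have hnn' : ∀ u ∈ S', 0 ≤ tensorForm (fun i j α β => h.curvatureCoeff x i j β α) u u :=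
    fun u hu => by
      rcases eq_or_ne u 0 with rfl | h0
      · simp
      · exact (hpos' u hu h0).le
  have hf : ∀ v ξ, h.form x (h.chernCurvature x v v ξ) ξ =
      tensorForm (h.curvatureCoeff x) (tensorCoord n r E x (P v) (P' ξ))
          (tensorCoord n r E x (P v) (P' ξ)) +
        tensorForm (fun i j α β => h.curvatureCoeff x i j β α)
          (tensorConjCoord n r E x (Q v) (Q' ξ)) (tensorConjCoord n r E x (Q v) (Q' ξ)) :=
    fun v ξ => by
      rw [hsplit, form_chernCurvature, form_chernCurvature, nakanoForm_eq_tensorForm_conj h x (Q v)]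
      rfl
  refine ⟨?_, fun v ξ hv hξ => ?_⟩
  · obtain ⟨φ, hφ⟩ := exists_sum_norm_sq_of_nonneg _ S hnn
    obtain ⟨ψ, hψ⟩ := exists_sum_norm_sq_of_nonneg _ S' hnn'
    -- Scaling every form by `c` absorbs the factor `1/(2π)`. Both families are indexed by the
    -- dimension of the same tensor space, so a single `N` serves both.
    let c : ℝ := √(1 / (2 * Real.pi))
    have hc : c ^ 2 = 1 / (2 * Real.pi) := Real.sq_sqrt (by positivity)
    have hcn : ∀ a : ℂ, ‖(c : ℂ) * a‖ ^ 2 = 1 / (2 * Real.pi) * ‖a‖ ^ 2 := fun a => by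
      rw [norm_mul, mul_pow, Complex.norm_real, Real.norm_eq_abs, sq_abs, hc]
    refine ⟨finrank ℂ (Fin r → Fin n → ℂ),
      fun p => LinearMap.mk₂'ₛₗ (starRingEnd ℂ) (RingHom.id ℂ)
        (fun v ξ => (c : ℂ) * ψ p (tensorConjCoord n r E x (Q v) (Q' ξ))) ?_ ?_ ?_ ?_,
      fun p => LinearMap.mk₂'ₛₗ (RingHom.id ℂ) (RingHom.id ℂ)
        (fun v ξ => (c : ℂ) * φ p (tensorCoord n r E x (P v) (P' ξ))) ?_ ?_ ?_ ?_,
      fun v ξ => ?_⟩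
    · intro v v' ξ
      rw [← mul_add, ← map_add]
      congr 2
      ext i α
      simp [tensorConjCoord, mul_add]
    · intro a v ξ
      rw [smul_eq_mul, mul_left_comm, ← smul_eq_mul (a := conj a), ← map_smul]
      congr 2
      ext i α
      simp [tensorConjCoord, mul_left_comm]
    · intro v ξ ξ'
      rw [← mul_add, ← map_add]
      congr 2
      ext i α
      simp [tensorConjCoord, add_mul]
    · intro a v ξ
      rw [smul_eq_mul, mul_left_comm, ← smul_eq_mul (a := (RingHom.id ℂ) a), ← map_smul]
      congr 2
      ext i α
      simp [tensorConjCoord, mul_assoc]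
    · intro v v' ξ
      rw [← mul_add, ← map_add]
      congr 2
      ext i α
      simp [tensorCoord, mul_add]
    · intro a v ξ
      rw [smul_eq_mul, mul_left_comm, ← smul_eq_mul (a := (RingHom.id ℂ) a), ← map_smul]
      congr 2
      ext i α
      simp [tensorCoord, mul_left_comm]
    · intro v ξ ξ'
      rw [← mul_add, ← map_add]
      congr 2
      ext i α
      simp [tensorCoord, add_mul]
    · intro a v ξ
      rw [smul_eq_mul, mul_left_comm, ← smul_eq_mul (a := (RingHom.id ℂ) a), ← map_smul]
      congr 2
      ext i α
      simp [tensorCoord, mul_assoc]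
    · rw [hf, hφ _ (hS v ξ), hψ _ (hS' v ξ)]
      simp only [LinearMap.mk₂'ₛₗ_apply, hcn, ← Finset.mul_sum]
      push_cast
      ring
  · rw [hf]
    rcases hne v ξ hv hξ with ⟨h1, h2⟩ | ⟨h1, h2⟩
    · exact (add_pos_of_pos_of_nonneg (hpos _ (hS v ξ) (tensorCoord_ne_zero h1 h2))
        (hnn' _ (hS' v ξ))).ne'
    · exact (add_pos_of_nonneg_of_pos (hnn _ (hS v ξ))
        (hpos' _ (hS' v ξ) (tensorConjCoord_ne_zero h1 h2))).ne'

end HermitianMetric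

end HermitianBundle

/-! ### The two types of strong decomposable positivity -/

namespace HermitianMetric

variable {n r : ℕ} {X : Type*} [TopologicalSpace X] [ChartedSpace (CSpace n) X]
  {E : X → Type*} [∀ x, AddCommGroup (E x)] [∀ x, Module ℂ (E x)] [∀ x, TopologicalSpace (E x)]
  [TopologicalSpace (TotalSpace (CSpace r) E)] [FiberBundle (CSpace r) E]
  [VectorBundle ℂ (CSpace r) E] {h : HermitianMetric n r E}

theorem StronglyDecomposablyPositiveI.decomposablyPositive
    (hI : h.StronglyDecomposablyPositiveI) : h.DecomposablyPositive := by
  refine forall_and.1 fun x => ?_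
  obtain ⟨U, V, hUV, hU, hcross, hV⟩ := hI x
  have hsum : ∀ v, U.projection V hUV v + V.projection U hUV.symm v = v :=
    fun v => Submodule.projection_add_projection_eq_self hUV v
  let S : Submodule ℂ (Fin r → Fin n → ℂ) :=
    { carrier := {u | ∀ i, ∑ α, u i α • tangentFrame x α ∈ U}
      zero_mem' := fun i => by simp
      add_mem' := fun {a b} ha hb i => by
        simpa [add_smul, Finset.sum_add_distrib] using U.add_mem (ha i) (hb i)
      smul_mem' := fun c a ha i => by
        simpa [mul_smul, Finset.smul_sum] using U.smul_mem c (ha i) }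
  -- These are the coordinates of `E_x ⊗ V̄`; conjugating them gives tensors in `Ē_x ⊗ V`, and the
  -- dual Nakano form of the conjugate is the index-swapped form of the original.
  let S' : Submodule ℂ (Fin r → Fin n → ℂ) :=
    { carrier := {u | ∀ i, ∑ α, conj (u i α) • tangentFrame x α ∈ V}
      zero_mem' := fun i => by simp
      add_mem' := fun {a b} ha hb i => by
        simpa [add_smul, Finset.sum_add_distrib] using V.add_mem (ha i) (hb i)
      smul_mem' := fun c a ha i => by
        simpa [mul_smul, Finset.smul_sum] using V.smul_mem (conj c) (ha i) }
  have hmem : ∀ (W : Submodule ℂ (TangentSpace 𝓘(ℂ, CSpace n) x)), ∀ v ∈ W, ∀ a : ℂ,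
      ∑ α, (a * (tangentFrame x).repr v α) • tangentFrame x α ∈ W := fun W v hv a => by
    simp only [mul_smul, ← Finset.smul_sum, (tangentFrame x).sum_repr]
    exact W.smul_mem a hv
  have hS : ∀ v ξ, tensorCoord n r E x (U.projection V hUV v) ξ ∈ S := fun v ξ i =>
    hmem U _ (Submodule.projection_apply_mem hUV v) _
  have hSV : ∀ v ξ i, ∑ α, tensorCoord n r E x (V.projection U hUV.symm v) ξ i α •
      tangentFrame x α ∈ V := fun v ξ i =>
    hmem V _ (Submodule.projection_apply_mem hUV.symm v) _
  refine h.exists_sum_norm_sq_of_split x (U.projection V hUV) (V.projection U hUV.symm)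
    LinearMap.id LinearMap.id S S' hS (fun v ξ i => ?_) hU (fun u hu hu0 => ?_)
    (fun v ξ => ?_) (fun v ξ hv hξ => ?_)
  · simpa [tensorConjCoord] using
      hmem V _ (Submodule.projection_apply_mem hUV.symm v) (conj ((fibreFrame E x).repr ξ i))
  · have h0 : (fun i α => conj (u i α)) ≠ 0 := fun h0 => hu0 <| by
      ext i α
      simpa using congrFun (congrFun h0 i) α
    refine (hV _ hu h0).trans_eq ?_
    simp only [dualNakanoForm, tensorForm_apply, Complex.conj_conj]
    refine Finset.sum_congr rfl fun i _ => Finset.sum_congr rfl fun j _ => ?_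
    rw [Finset.sum_comm]
    refine Finset.sum_congr rfl fun α _ => Finset.sum_congr rfl fun β _ => ?_
    ring
  · have h1 := hcross _ _ (hS v ξ) (hSV v ξ)
    -- The hypothesis kills only the `U`–`V` cross term; the `V`–`U` one is its conjugate.
    have h2 := h.conj_nakanoForm x (tensorCoord n r E x (U.projection V hUV v) ξ)
      (tensorCoord n r E x (V.projection U hUV.symm v) ξ)
    rw [h1, map_zero] at h2
    rw [← form_chernCurvature] at h1 h2
    conv_lhs => rw [← hsum v]
    simp only [chernCurvature_add_left, chernCurvature_add_right, LinearMap.add_apply, map_add,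
      h1, ← h2, LinearMap.id_apply]
    ring
  -- As `ξ ≠ 0`, failure of both alternatives makes both components of `v` vanish.
  · by_contra! hc
    refine hv ?_
    rw [← hsum v, by_contra fun h' => hξ (hc.1 h'), by_contra fun h' => hξ (hc.2 h'), add_zero]

theorem StronglyDecomposablyPositiveII.decomposablyPositive
    (hII : h.StronglyDecomposablyPositiveII) : h.DecomposablyPositive := by
  refine forall_and.1 fun x => ?_
  obtain ⟨E₁, E₂, hE, horth, hR, h1, h2⟩ := hII x
  have hsum : ∀ ξ, E₁.projection E₂ hE ξ + E₂.projection E₁ hE.symm ξ = ξ :=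
    fun ξ => Submodule.projection_add_projection_eq_self hE ξ
  let S : Submodule ℂ (E x) → Submodule ℂ (Fin r → Fin n → ℂ) := fun F =>
    { carrier := {u | ∀ α, ∑ i, u i α • fibreFrame E x i ∈ F}
      zero_mem' := fun α => by simp
      add_mem' := fun {a b} ha hb α => by
        simpa [add_smul, Finset.sum_add_distrib] using F.add_mem (ha α) (hb α)
      smul_mem' := fun c a ha α => by
        simpa [mul_smul, Finset.smul_sum] using F.smul_mem c (ha α) }
  have hmem : ∀ (F : Submodule ℂ (E x)), ∀ ξ ∈ F, ∀ a : ℂ,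
      ∑ i, ((fibreFrame (r := r) E x).repr ξ i * a) • fibreFrame (r := r) E x i ∈ F :=
    fun F ξ hξ a => by
      simp only [mul_comm _ a, mul_smul, ← Finset.smul_sum, Basis.sum_repr]
      exact F.smul_mem a hξ
  refine h.exists_sum_norm_sq_of_split x LinearMap.id LinearMap.id
    (E₁.projection E₂ hE) (E₂.projection E₁ hE.symm) (S E₁) (S E₂)
    (fun v ξ α => hmem E₁ _ (Submodule.projection_apply_mem hE ξ) _)
    (fun v ξ α => hmem E₂ _ (Submodule.projection_apply_mem hE.symm ξ) _)
    h1 (fun u hu hu0 => ?_) (fun v ξ => ?_) (fun v ξ hv hξ => ?_)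
  · refine (h2 u hu hu0).trans_eq ?_
    rw [tensorForm_apply]
    exact Finset.sum_congr rfl fun i _ => Finset.sum_congr rfl fun j _ => Finset.sum_comm
  · have ha := Submodule.projection_apply_mem hE ξ
    have hb := Submodule.projection_apply_mem hE.symm ξ
    -- Since `R` preserves each block, `⟨Rξ₁, ξ₂⟩` vanishes by orthogonality, and `⟨Rξ₂, ξ₁⟩` is the
    -- conjugate of `⟨ξ₁, Rξ₂⟩ = 0`.
    have h12 := horth _ ((hR v v).1 _ ha) _ hb
    have h21 := h.conj_symm x _ _ ▸ congrArg conj (horth _ ha _ ((hR v v).2 _ hb))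
    rw [map_zero] at h21
    conv_lhs => rw [← hsum ξ]
    simp only [map_add, LinearMap.add_apply, h12, h21, LinearMap.id_apply]
    ring
  · by_contra! hc
    refine hξ ?_
    rw [← hsum ξ, hc.1 hv, hc.2 hv, add_zero]

end HermitianMetric

theorem corollary2p6 {n r : ℕ}
    {X : Type*} [TopologicalSpace X] [ChartedSpace (CSpace n) X]
    [IsManifold 𝓘(ℂ, CSpace n) ω X]
    (E : X → Type*) [∀ x, AddCommGroup (E x)] [∀ x, Module ℂ (E x)]
    [∀ x, TopologicalSpace (E x)] [TopologicalSpace (TotalSpace (CSpace r) E)]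
    [FiberBundle (CSpace r) E] [VectorBundle ℂ (CSpace r) E]
    [ContMDiffVectorBundle ω (CSpace r) E 𝓘(ℂ, CSpace n)]
    (h : HermitianMetric n r E)
    (hpos : h.StronglyDecomposablyPositiveI ∨ h.StronglyDecomposablyPositiveII) :
    h.DecomposablyPositive := by
  exact hpos.elim (fun hI => hI.decomposablyPositive) fun hII => hII.decomposablyPositive
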